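/- Let $\mathcal X$ be a finite set, and for every $\theta\in\mathbb R$ let $P_\theta$ be a stochastic matrix on $\mathcal X$ with a stationary probability distribution $m_\theta$. Let $F:\mathbb R\times\mathcal X\to\mathbb R$ be a cost and $f(\theta)=\mathbb E[F(\theta,X_\infty^\theta)]=\sum_{x}m_\theta(x)F(\theta,x)$, where $X_\infty^\theta$ has law $m_\theta$. Fix $K\ge 1$, $\theta_0\in\mathbb R$, $x_{\rm start}\in\mathcal X$, positive sequences $(a_n)_{n\ge0}$, $(\delta_n)_{n\ge0}$ and nonnegative integers $(\tau_n)_{n\ge0}$. *The scheme.* In episode $n\ge 0$, given the past, simulate $2K$ independent Markov chains started at $x_{\rm start}$ for $\tau_n$ steps, $K$ of them with transition matrix $P_{\theta_n+\delta_n}$ and final states $X_{n,i}^{+}$, and $K$ with transition matrix $P_{\theta_n-\delta_n}$ and final states $X_{n,i}^{-}$ ($0\le i<K$). Put $\hat f_n(\theta_n\pm\delta_n)=\frac1K\sum_{i=0}^{K-1}F(\theta_n\pm\delta_n,X_{n,i}^{\pm})$ and $$\theta_{n+1}=\theta_n-a_n\,\frac{\hat f_n(\theta_n+\delta_n)-\hat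 f_n(\theta_n-\delta_n)}{2\delta_n}.$$ *Assumptions.* 1. (Regularity) $f$ is $\mathcal C^3$ and $f'$ is Lipschitz; $F(\theta,x)=g(\theta,x)+b(\theta)$ with $0\le g\le g_{\max}$ for a constant $g_{\max}$, and there are $C_2,\varepsilon_0>0$ with $|b(\theta+\varepsilon)-b(\theta-\varepsilon)|\le C_2|\theta-\theta^*|\varepsilon$ for all $\theta$ and $0<\varepsilon<\varepsilon_0$; there are $L,r>0$ with $f'(\theta)>r$ for $\theta>L$ and $f'(\theta)<-r$ for $\theta<-L$. 2. (Uniform mixing) There are $C_1>0$ and $\rho<1$ such that $\|P_\theta^t(x_{\rm start},\cdot)-m_\theta\|_1\le C_1\rho^t$ for all $\theta\in\mathbb R$ and all integers $t\ge0$. 3. (Uniqueness) $\theta^*$ is a minimizer of $f$ and the only zero of $f'$, that is, the only equilibrium of the flow $\dot\theta=-f'(\theta)$. 4. (Parameters) $\delta_n\to0$, $\tau_n\to\infty$, $\sum_n a_n=\infty$, $\sum_n a_n^2\delta_n^{-2}<\infty$; the sequences $(a_n)$, $(\delta_n)$ and $(a_n/\delta_n)$ are nonincreasing; and $\sum_n\rho^{\tau_n}<\infty$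 (as is the case when $\tau_n$ is $\tau\log(n+1)$, rounded to an integer, with $0<\rho<1$ and $\tau\log(1/\rho)>1$). Then $\theta_n\to\theta^*$ almost surely. -/

import Mathlib

open Filter Topology MeasureTheory

noncomputable section

namespace KieferWolfowitz

/-- The input of the scheme: transition matrices `P θ`, costs `F θ x`, number `K` of simulations
for each of the two parameters, step sizes `a n`, discretization steps `δ n`, lengths `τ n` of the
simulations of episode `n`, initial parameter `θ₀` and initial state `xstart`. -/
structure Input (S : Type*) where
  P : ℝ → Matrix S S ℝ
  F : ℝ → S → ℝ
  K : ℕ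
  a : ℕ → ℝ
  δ : ℕ → ℝ
  τ : ℕ → ℕ
  θ₀ : ℝ
  xstart : S

variable {S : Type*}

/-- The empirical mean of the cost `F θ` over the `K` states `x i`. -/
def Input.fHat (D : Input S) (θ : ℝ) (x : Fin D.K → S) : ℝ :=
  (1 / (D.K : ℝ)) * ∑ i, D.F θ (x i)

/-- The iterates `θ_n` computed from the simulated trajectories: `yp n i t` (resp. `ym n i t`) is
the state at time `t` of the `i`-th simulation with parameter `θ_n + δ_n` (resp. `θ_n - δ_n`)
in episode `n`. Only the final states, at time `t = τ n`, enter the gradient estimate. -/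
def Input.iterate (D : Input S) (yp ym : ℕ → Fin D.K → ℕ → S) : ℕ → ℝ
  | 0 => D.θ₀
  | n + 1 =>
    D.iterate yp ym n - D.a n *
      ((D.fHat (D.iterate yp ym n + D.δ n) (fun i => yp n i (D.τ n))
        - D.fHat (D.iterate yp ym n - D.δ n) (fun i => ym n i (D.τ n))) / (2 * D.δ n))

/-- The probability that a Markov chain with transition matrix `P` started at `x` follows the
path `w 0, w 1, …, w T` during its first `T` steps. -/
def pathProb [DecidableEq S] (P : Matrix S S ℝ) (x : S) (T : ℕ) (w : ℕ → S) : ℝ :=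
  (if w 0 = x then 1 else 0) * ∏ t ∈ Finset.range T, P (w t) (w (t + 1))

/-- `Xp`, `Xm` are the trajectories simulated by the scheme: given the past episodes, those of
episode `n` are independent Markov chains started at `xstart`, run for `τ n` steps, with transition
matrix `P (θ_n + δ_n)` for `Xp n i` and `P (θ_n - δ_n)` for `Xm n i`. Equivalently, the joint law
of the trajectories of the first `N` episodes is the product below. -/
structure Input.IsSimulation [DecidableEq S] [MeasurableSpace S] (D : Input S)
    {Ω : Type*} [MeasurableSpace Ω] (μ : Measure Ω)
    (Xp Xm : ℕ → Fin D.K → ℕ → Ω → S) : Prop where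
  measurable_plus : ∀ n i t, Measurable (Xp n i t)
  measurable_minus : ∀ n i t, Measurable (Xm n i t)
  law : ∀ (N : ℕ) (yp ym : ℕ → Fin D.K → ℕ → S),
    μ.real {ω | ∀ n < N, ∀ i, ∀ t ≤ D.τ n,
        Xp n i t ω = yp n i t ∧ Xm n i t ω = ym n i t}
      = ∏ n ∈ Finset.range N, ∏ i : Fin D.K,
          (pathProb (D.P (D.iterate yp ym n + D.δ n)) D.xstart (D.τ n) (yp n i)
            * pathProb (D.P (D.iterate yp ym n - D.δ n)) D.xstart (D.τ n) (ym n i))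

/-- `m` is a stationary probability distribution of the transition matrix `P`. -/
def IsStationary [Fintype S] (P : Matrix S S ℝ) (m : S → ℝ) : Prop :=
  m ∈ stdSimplex ℝ S ∧ Matrix.vecMul m P = m

/-- The expected stationary cost `f θ = E[F(θ, X)]`, `X` of law `m θ`. -/
def Input.statCost [Fintype S] (D : Input S) (m : ℝ → S → ℝ) (θ : ℝ) : ℝ :=
  ∑ x, m θ x * D.F θ x

/-- Regularity of the cost function. -/
structure RegularCost (F : ℝ → S → ℝ) (f : ℝ → ℝ) (θstar : ℝ) : Prop where
  contDiff : ContDiff ℝ 3 f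
  lipschitz : ∃ Λ, LipschitzWith Λ (deriv f)
  decomposition : ∃ (g : ℝ → S → ℝ) (b : ℝ → ℝ) (gmax C₂ ε₀ : ℝ), 0 < C₂ ∧ 0 < ε₀ ∧
    (∀ θ x, F θ x = g θ x + b θ) ∧
    (∀ θ x, 0 ≤ g θ x ∧ g θ x ≤ gmax) ∧
    (∀ θ ε, 0 < ε → ε < ε₀ → |b (θ + ε) - b (θ - ε)| ≤ C₂ * |θ - θstar| * ε)
  drift : ∃ L r : ℝ, 0 < L ∧ 0 < r ∧
    (∀ θ, L < θ → r < deriv f θ) ∧ (∀ θ, θ < -L → deriv f θ < -r)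

/-- Geometric mixing from the state `x`, uniformly in the parameter, with constants `C₁`, `ρ`. -/
def UniformMixing [Fintype S] [DecidableEq S] (P : ℝ → Matrix S S ℝ) (m : ℝ → S → ℝ)
    (x : S) (C₁ ρ : ℝ) : Prop :=
  0 < C₁ ∧ ρ < 1 ∧ ∀ (θ : ℝ) (t : ℕ), ∑ y, |(P θ ^ t) x y - m θ y| ≤ C₁ * ρ ^ t

/-- The conditions on the step sizes, the discretization steps and the simulation lengths that
do not involve the mixing rate. -/
structure Input.Parametrization (D : Input S) : Prop where
  a_pos : ∀ n, 0 < D.a n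
  δ_pos : ∀ n, 0 < D.δ n
  δ_tendsto : Tendsto D.δ atTop (𝓝 0)
  τ_tendsto : Tendsto D.τ atTop atTop
  a_sum : Tendsto (fun N => ∑ n ∈ Finset.range N, D.a n) atTop atTop
  a_sq_sum : Summable (fun n => D.a n ^ 2 / D.δ n ^ 2)
  a_antitone : Antitone D.a
  δ_antitone : Antitone D.δ
  ratio_antitone : Antitone (fun n => D.a n / D.δ n)

end KieferWolfowitz

end

/-!
The scheme is a perturbed gradient recursion
`θ_{n+1} = θ_n - a_n (f'(θ_n) + e_n) - w_n`, in which the perturbation splits into three parts.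

* `e_n`, the difference between the central difference quotient of `f` and `f'`, is at most
  `Λ δ_n` in absolute value, because `f'` is `Λ`-Lipschitz (`abs_centralDiff_sub_deriv_le`). It
  only has to vanish in the limit.
* The bias of the truncated simulations contributes to `w_n` a term of order
  `(a_n / δ_n) ρ ^ τ_n`, which is summable because `a_n / δ_n` is bounded
  (`abs_simCost_sub_statCost_le`).
* The centred noise `a_n ξ_n` is a martingale difference for the filtration of the past episodes,
  bounded by `gmax a_n / δ_n`: the state-independent part `b` of the cost is cancelled by centring
  (`abs_noise_le`). These bounds are square summable, so the noise series is an `L²`-bounded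
  martingale and converges almost surely (`ae_exists_tendsto_sum_of_condExp_eq_zero`).

The rest is deterministic and pathwise. Since `f'` vanishes only at `θ*`, it is bounded away
from zero outside each neighbourhood of `θ*`, with the sign that pushes the iterates back
(`exists_pos_le_of_forall_ne_zero`). Subtracting from `θ_n` the tail of the convergent series
`∑ w_n` leaves a recursion with vanishing errors only, whose distance to `θ*` decreases by at least
a fixed multiple of `a_n` as long as it exceeds `ε`; as `∑ a_n = ∞` and `a_n → 0`, it ends up, and
stays, below `2 ε` (`tendsto_of_recursion`).

The conditional law of an episode given the past is read off from the product formula for the joint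
law: histories and episodes are random variables with values in finite types, so conditional
expectations reduce to finite sums (`condExp_comap_eq_zero`).
-/


/-! ### The deterministic recursion -/

/-- A continuous function without zeros to the right of `s` which is bounded below by `r > 0`
near infinity is bounded below by a positive constant on `[s + ε, ∞)`. -/
theorem exists_pos_le_of_forall_ne_zero {h : ℝ → ℝ} (hc : Continuous h) {s L r : ℝ} (hr : 0 < r)
    (hne : ∀ x, s < x → h x ≠ 0) (hL : ∀ x, L < x → r < h x) {ε : ℝ} (hε : 0 < ε) :
    ∃ c > 0, ∀ x, s + ε ≤ x → c ≤ h x := by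
  have hpos : ∀ x, s < x → 0 < h x := by
    intro x hx
    by_contra! hle
    have hy : r < h (max x L + 1) := hL _ (by linarith [le_max_right x L])
    have hxy : x ≤ max x L + 1 := by linarith [le_max_left x L]
    obtain ⟨z, hz, hz0⟩ := intermediate_value_Icc hxy hc.continuousOn ⟨hle, (hr.trans hy).le⟩
    exact hne z (hx.trans_le hz.1) hz0
  obtain ⟨z, hz, hzmin⟩ := isCompact_Icc.exists_isMinOn
    (Set.nonempty_Icc.2 (le_max_left (s + ε) L)) hc.continuousOn
  refine ⟨min (h z) r, lt_min (hpos z (by linarith [hz.1])) hr, fun x hx => ?_⟩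
  rcases le_or_gt x (max (s + ε) L) with h1 | h1
  · exact (min_le_left _ _).trans (hzmin ⟨hx, h1⟩)
  · exact (min_le_right _ _).trans (hL x ((le_max_right _ _).trans_lt h1)).le

/-- The central difference quotient approximates a `Λ`-Lipschitz derivative up to `Λ * δ`. -/
theorem abs_centralDiff_sub_deriv_le {f : ℝ → ℝ} (hf : Differentiable ℝ f) {Λ : NNReal}
    (hΛ : LipschitzWith Λ (deriv f)) (θ : ℝ) {δ : ℝ} (hδ : 0 < δ) :
    |(f (θ + δ) - f (θ - δ)) / (2 * δ) - deriv f θ| ≤ Λ * δ := by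
  obtain ⟨c, hc, hcd⟩ := exists_deriv_eq_slope f (show θ - δ < θ + δ by linarith)
    hf.continuous.continuousOn hf.differentiableOn
  have h1 : θ + δ - (θ - δ) = 2 * δ := by ring
  rw [← h1, ← hcd]
  refine (by simpa [Real.dist_eq] using hΛ.dist_le_mul c θ :
    |deriv f c - deriv f θ| ≤ Λ * |c - θ|).trans ?_
  have : |c - θ| ≤ δ := abs_le.2 ⟨by linarith [hc.1], by linarith [hc.2]⟩
  gcongr

/-- A perturbed gradient recursion with vanishing steps `a n` of infinite total length and
vanishing errors `e n` converges to the point `s` that the drift `-h` pushes towards. -/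
theorem tendsto_of_recursion_of_tendsto_zero {h : ℝ → ℝ} {Λ : NNReal} (hh : LipschitzWith Λ h)
    {s : ℝ} (hs : h s = 0)
    (hsep : ∀ ε > 0, ∃ c > 0, ∀ x, (s + ε ≤ x → c ≤ h x) ∧ (x ≤ s - ε → h x ≤ -c))
    {a e θ : ℕ → ℝ} (ha : ∀ n, 0 < a n) (ha0 : Tendsto a atTop (𝓝 0))
    (hasum : Tendsto (fun N => ∑ n ∈ Finset.range N, a n) atTop atTop)
    (he : Tendsto e atTop (𝓝 0))
    (hrec : ∀ n, θ (n + 1) = θ n - a n * (h (θ n) + e n)) :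
    Tendsto θ atTop (𝓝 s) := by
  have hlip : ∀ x, |h x| ≤ Λ * |x - s| := fun x => by
    simpa [Real.dist_eq, hs] using hh.dist_le_mul x s
  rw [Metric.tendsto_atTop]
  intro η hη
  obtain ⟨ε, hε, hεη⟩ : ∃ ε : ℝ, 0 < ε ∧ 2 * ε < η := ⟨η / 4, by positivity, by linarith⟩
  obtain ⟨c, hc, hcs⟩ := hsep ε hε
  have hev : ∀ᶠ n in atTop, |e n| ≤ c / 2 ∧ a n * Λ ≤ 1 ∧ a n * (Λ * ε + c / 2) ≤ ε := by
    have h1 : ∀ᶠ n in atTop, |e n| < c / 2 :=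
      (by simpa using he.abs : Tendsto (fun n => |e n|) atTop (𝓝 0)).eventually_lt_const
        (by positivity)
    have h2 : ∀ᶠ n in atTop, a n * Λ < 1 :=
      (by simpa using ha0.mul_const (Λ : ℝ) :
        Tendsto (fun n => a n * Λ) atTop (𝓝 0)).eventually_lt_const (by norm_num)
    have h3 : ∀ᶠ n in atTop, a n * (Λ * ε + c / 2) < ε :=
      (by simpa using ha0.mul_const (Λ * ε + c / 2) :
        Tendsto (fun n => a n * (Λ * ε + c / 2)) atTop (𝓝 0)).eventually_lt_const hε
    filter_upwards [h1, h2, h3] with n h1 h2 h3 using ⟨h1.le, h2.le, h3.le⟩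
  obtain ⟨N, hN⟩ := eventually_atTop.1 hev
  -- Away from `s`, the distance to `s` shrinks by a fixed fraction of the step.
  have hfar : ∀ n ≥ N, ε ≤ |θ n - s| → |θ (n + 1) - s| ≤ |θ n - s| - a n * (c / 2) := by
    intro n hn hd
    obtain ⟨h1, h2, -⟩ := hN n hn
    have hn0 := ha n
    have hl := hlip (θ n)
    have h1' := abs_le.1 h1
    have h4 : a n * |h (θ n)| ≤ |θ n - s| := by
      calc a n * |h (θ n)| ≤ a n * (Λ * |θ n - s|) := by gcongr
        _ = (a n * Λ) * |θ n - s| := by ring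
        _ ≤ 1 * |θ n - s| := by gcongr
        _ = _ := one_mul _
    have h5 : a n * |e n| ≤ a n * (c / 2) := by gcongr
    have h5' : |a n * e n| ≤ a n * (c / 2) := by rwa [abs_mul, abs_of_pos hn0]
    have h5'' := abs_le.1 h5'
    rw [hrec, mul_add]
    rcases le_total 0 (θ n - s) with hp | hp
    · rw [abs_of_nonneg hp] at hd h4 ⊢
      have h6 := (hcs (θ n)).1 (by linarith)
      have h7 : a n * c ≤ a n * h (θ n) := by gcongr
      rw [abs_of_nonneg (by linarith)] at h4
      rw [abs_le]
      constructor <;> nlinarith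
    · rw [abs_of_nonpos hp] at hd h4 ⊢
      have h6 := (hcs (θ n)).2 (by linarith)
      have h7 : a n * c ≤ a n * -h (θ n) := by gcongr; linarith
      rw [abs_of_nonpos (by linarith)] at h4
      rw [abs_le]
      constructor <;> nlinarith
  have hnear : ∀ n ≥ N, |θ n - s| ≤ ε → |θ (n + 1) - s| ≤ 2 * ε := by
    intro n hn hd
    obtain ⟨h1, -, h3⟩ := hN n hn
    have hl := hlip (θ n)
    calc |θ (n + 1) - s| = |(θ n - s) - a n * (h (θ n) + e n)| := by rw [hrec]; ring_nf
      _ ≤ |θ n - s| + |a n * (h (θ n) + e n)| := abs_sub _ _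
      _ = |θ n - s| + a n * |h (θ n) + e n| := by rw [abs_mul, abs_of_pos (ha n)]
      _ ≤ ε + a n * (Λ * ε + c / 2) := by
        have := (ha n).le
        gcongr
        refine (abs_add_le _ _).trans (add_le_add (hl.trans ?_) h1)
        gcongr
      _ ≤ 2 * ε := by linarith
  have hstay : ∀ n ≥ N, |θ n - s| ≤ 2 * ε → |θ (n + 1) - s| ≤ 2 * ε := by
    intro n hn hd
    rcases le_total ε |θ n - s| with h1 | h1
    · have := hfar n hn h1
      have := mul_pos (ha n) (half_pos hc)
      linarith
    · exact hnear n hn h1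
  obtain ⟨M, hM, hMd⟩ : ∃ M ≥ N, |θ M - s| ≤ 2 * ε := by
    by_contra! hcon
    -- The quantity `|θ n - s| + (c / 2) * ∑ k < n, a k` would be bounded.
    have hb : ∀ n ≥ N, |θ n - s| + c / 2 * ∑ k ∈ Finset.range n, a k
        ≤ |θ N - s| + c / 2 * ∑ k ∈ Finset.range N, a k := by
      intro n hn
      induction n, hn using Nat.le_induction with
      | base => exact le_rfl
      | succ n hn ih =>
        have := hfar n hn (by linarith [hcon n hn])
        rw [Finset.sum_range_succ]
        linarith
    obtain ⟨n, hn, hn'⟩ := ((hasum.const_mul_atTop (half_pos hc)).eventually_gt_atTop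
      (|θ N - s| + c / 2 * ∑ k ∈ Finset.range N, a k)).and (eventually_ge_atTop N) |>.exists
    linarith [hb n hn', abs_nonneg (θ n - s)]
  refine ⟨M, fun n hn => ?_⟩
  rw [Real.dist_eq]
  refine lt_of_le_of_lt ?_ hεη
  induction n, hn using Nat.le_induction with
  | base => exact hMd
  | succ n hn ih => exact hstay n (hM.trans hn) ih

/-- The recursion of `tendsto_of_recursion_of_tendsto_zero` with additional perturbations `w n`
whose series converges, possibly only conditionally. -/
theorem tendsto_of_recursion {h : ℝ → ℝ} {Λ : NNReal} (hh : LipschitzWith Λ h)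
    {s : ℝ} (hs : h s = 0)
    (hsep : ∀ ε > 0, ∃ c > 0, ∀ x, (s + ε ≤ x → c ≤ h x) ∧ (x ≤ s - ε → h x ≤ -c))
    {a e w θ : ℕ → ℝ} (ha : ∀ n, 0 < a n) (ha0 : Tendsto a atTop (𝓝 0))
    (hasum : Tendsto (fun N => ∑ n ∈ Finset.range N, a n) atTop atTop)
    (he : Tendsto e atTop (𝓝 0))
    {l : ℝ} (hw : Tendsto (fun N => ∑ n ∈ Finset.range N, w n) atTop (𝓝 l))
    (hrec : ∀ n, θ (n + 1) = θ n - a n * (h (θ n) + e n) - w n) :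
    Tendsto θ atTop (𝓝 s) := by
  -- Subtracting the tail of the series absorbs `w n`; the Lipschitz bound keeps the new
  -- errors vanishing.
  set r : ℕ → ℝ := fun n => ∑ k ∈ Finset.range n, w k - l with hr
  have hr0 : Tendsto r atTop (𝓝 0) := by simpa [hr] using hw.sub_const l
  have hφ : Tendsto (fun n => θ n + r n) atTop (𝓝 s) := by
    refine tendsto_of_recursion_of_tendsto_zero hh hs hsep ha ha0 hasum
      (e := fun n => e n + (h (θ n) - h (θ n + r n))) ?_ ?_
    · have h1 : Tendsto (fun n => h (θ n) - h (θ n + r n)) atTop (𝓝 0) := by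
        refine squeeze_zero_norm (a := fun n => Λ * |r n|) (fun n => ?_)
          (by simpa using hr0.abs.const_mul (Λ : ℝ))
        simpa [Real.dist_eq] using hh.dist_le_mul (θ n) (θ n + r n)
      simpa using he.add h1
    · intro n
      simp only [hr, hrec, Finset.sum_range_succ]
      ring
  simpa using hφ.sub hr0

/-! ### Convergence of bounded martingale difference series -/

/-- A series of martingale differences bounded by square summable constants converges almost
surely: its partial sums form a martingale bounded in `L²`. -/
theorem ae_exists_tendsto_sum_of_condExp_eq_zero {Ω : Type*} {m0 : MeasurableSpace Ω}
    {μ : Measure Ω} [IsProbabilityMeasure μ] {ℱ : Filtration ℕ m0} {ξ : ℕ → Ω → ℝ} {c : ℕ → ℝ}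
    (hc : Summable fun n => c n ^ 2) (hmeas : ∀ n, StronglyMeasurable[ℱ (n + 1)] (ξ n))
    (hbd : ∀ n ω, |ξ n ω| ≤ c n) (hce : ∀ n, μ[ξ n|ℱ n] =ᵐ[μ] 0) :
    ∀ᵐ ω ∂μ, ∃ l, Tendsto (fun n => ∑ k ∈ Finset.range n, ξ k ω) atTop (𝓝 l) := by
  set M : ℕ → Ω → ℝ := fun n ω => ∑ k ∈ Finset.range n, ξ k ω with hM
  have hMsucc : ∀ n ω, M (n + 1) ω = M n ω + ξ n ω := fun n ω => Finset.sum_range_succ _ _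
  have hMmeas : ∀ n, StronglyMeasurable[ℱ n] (M n) := fun n =>
    Finset.stronglyMeasurable_fun_sum _ fun k hk =>
      (hmeas k).mono (ℱ.mono (Finset.mem_range.1 hk))
  have hξLp : ∀ n, MemLp (ξ n) ⊤ μ := fun n =>
    MemLp.of_bound ((hmeas n).mono (ℱ.le _)).aestronglyMeasurable (c n)
      (Eventually.of_forall fun ω => hbd n ω)
  have hMLp : ∀ n, MemLp (M n) ⊤ μ := fun n => memLp_finsetSum _ fun k _ => hξLp k
  have hint : ∀ {u : Ω → ℝ}, MemLp u ⊤ μ → Integrable u μ := fun hu => hu.integrable le_top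
  have hmul : ∀ {u v : Ω → ℝ}, MemLp u ⊤ μ → MemLp v ⊤ μ → Integrable (fun ω => u ω * v ω) μ :=
    fun hu hv => hint (hv.mul hu)
  have hmart : Martingale M ℱ μ := by
    refine martingale_of_condExp_sub_eq_zero_nat hMmeas (fun n => hint (hMLp n)) fun n => ?_
    have : M (n + 1) - M n = ξ n := by ext ω; simp [hMsucc]
    rw [this]
    exact hce n
  have horth : ∀ n, ∫ ω, M n ω * ξ n ω ∂μ = 0 := by
    intro n
    have h1 : μ[M n * ξ n|ℱ n] =ᵐ[μ] M n * μ[ξ n|ℱ n] :=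
      condExp_mul_of_stronglyMeasurable_left (hMmeas n) (hmul (hMLp n) (hξLp n)) (hint (hξLp n))
    have h2 : μ[M n * ξ n|ℱ n] =ᵐ[μ] 0 := by
      filter_upwards [h1, hce n] with ω h1 h2
      rw [h1]; simp [h2]
    have h3 := integral_condExp (ℱ.le n) (μ := μ) (f := M n * ξ n)
    rw [integral_congr_ae h2] at h3
    simpa using h3.symm
  have hsq : ∀ n, ∫ ω, M n ω * M n ω ∂μ ≤ ∑ k ∈ Finset.range n, c k ^ 2 := by
    intro n
    induction n with
    | zero => simp [hM]
    | succ n ih =>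
      have h1 : ∫ ω, M (n + 1) ω * M (n + 1) ω ∂μ
          = ∫ ω, M n ω * M n ω ∂μ + 2 * ∫ ω, M n ω * ξ n ω ∂μ + ∫ ω, ξ n ω * ξ n ω ∂μ := by
        have i1 := hmul (hMLp n) (hMLp n)
        have i2 := (hmul (hMLp n) (hξLp n)).const_mul 2
        have i12 : Integrable (fun ω => M n ω * M n ω + 2 * (M n ω * ξ n ω)) μ := i1.add i2
        rw [← integral_const_mul, ← integral_add i1 i2,
          ← integral_add i12 (hmul (hξLp n) (hξLp n))]
        refine integral_congr_ae (Eventually.of_forall fun ω => ?_)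
        simp only [hMsucc]
        ring
      have h2 : ∫ ω, ξ n ω * ξ n ω ∂μ ≤ c n ^ 2 := by
        have := integral_mono (hmul (hξLp n) (hξLp n)) (integrable_const (c n ^ 2)) (μ := μ)
          fun ω => by
            have := hbd n ω
            have h0 := abs_nonneg (ξ n ω)
            change ξ n ω * ξ n ω ≤ c n ^ 2
            rw [← abs_mul_abs_self]
            nlinarith
        simpa using this
      rw [h1, horth, Finset.sum_range_succ]
      linarith
  have hL1 : ∀ n, eLpNorm (M n) 1 μ ≤ ((1 + ∑' k, c k ^ 2).toNNReal : NNReal) := by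
    intro n
    rw [eLpNorm_one_eq_lintegral_enorm, ← ofReal_integral_norm_eq_lintegral_enorm (hint (hMLp n))]
    refine ENNReal.ofReal_le_ofReal ?_
    calc ∫ ω, ‖M n ω‖ ∂μ ≤ ∫ ω, (1 + M n ω * M n ω) ∂μ :=
          integral_mono (hint (hMLp n)).norm ((integrable_const 1).add (hmul (hMLp n) (hMLp n)))
            fun ω => by
              change |M n ω| ≤ 1 + M n ω * M n ω
              rw [← abs_mul_abs_self (M n ω)]
              nlinarith [sq_nonneg (|M n ω| - 1), abs_nonneg (M n ω)]
      _ = 1 + ∫ ω, M n ω * M n ω ∂μ := by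
          rw [integral_add (integrable_const 1) (hmul (hMLp n) (hMLp n))]; simp
      _ ≤ 1 + ∑' k, c k ^ 2 := by
          gcongr
          exact (hsq n).trans (hc.sum_le_tsum _ fun k _ => sq_nonneg _)
  filter_upwards [hmart.submartingale.ae_tendsto_limitProcess hL1] with ω hω using ⟨_, hω⟩

/-- If, given the value `h` of `H`, the finite random variable `Y` has law `q h`, and
`Φ h` has mean zero under `q h`, then `Φ (H, Y)` has conditional mean zero given `H`. -/
theorem condExp_comap_eq_zero {Ω A B : Type*} [m0 : MeasurableSpace Ω] {μ : Measure Ω}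
    [IsProbabilityMeasure μ] [Fintype A] [Fintype B] [mA : MeasurableSpace A]
    [MeasurableSpace B] [MeasurableSingletonClass A] [MeasurableSingletonClass B]
    {H : Ω → A} {Y : Ω → B} (hH : Measurable H) (hY : Measurable Y)
    {p : A → ℝ} {q : A → B → ℝ} (hpq : ∀ h y, μ.real {ω | H ω = h ∧ Y ω = y} = p h * q h y)
    {Φ : A → B → ℝ} (hΦ : ∀ h, ∑ y, q h y * Φ h y = 0) :
    μ[fun ω => Φ (H ω) (Y ω)|mA.comap H] =ᵐ[μ] 0 := by
  classical
  have hHY : Measurable fun ω => (H ω, Y ω) := hH.prodMk hY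
  have hexp : ∀ Ψ : A × B → ℝ, Integrable (fun ω => Ψ (H ω, Y ω)) μ ∧
      ∫ ω, Ψ (H ω, Y ω) ∂μ = ∑ h, p h * ∑ y, q h y * Ψ (h, y) := by
    intro Ψ
    have hΨ : Measurable Ψ := measurable_of_finite Ψ
    have : IsProbabilityMeasure (μ.map fun ω => (H ω, Y ω)) :=
      Measure.isProbabilityMeasure_map hHY.aemeasurable
    have hi : Integrable Ψ (μ.map fun ω => (H ω, Y ω)) := Integrable.of_finite
    refine ⟨hi.comp_measurable hHY, ?_⟩
    rw [← integral_map hHY.aemeasurable hΨ.aestronglyMeasurable, integral_fintype hi,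
      Fintype.sum_prod_type]
    refine Finset.sum_congr rfl fun h _ => ?_
    rw [Finset.mul_sum]
    refine Finset.sum_congr rfl fun y _ => ?_
    rw [map_measureReal_apply hHY (measurableSet_singleton _), ← mul_assoc, ← hpq, smul_eq_mul]
    congr 2
    ext ω
    simp
  refine (ae_eq_condExp_of_forall_setIntegral_eq hH.comap_le
    (hexp (fun x : A × B => Φ x.1 x.2)).1 (fun s _ _ => integrableOn_zero) ?_
    aestronglyMeasurable_zero).symm
  rintro s ⟨t, ht, rfl⟩ -
  simp only [integral_zero]
  rw [← integral_indicator (hH ht)]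
  have h1 : (H ⁻¹' t).indicator (fun ω => Φ (H ω) (Y ω))
      = fun ω => (fun x : A × B => if x.1 ∈ t then Φ x.1 x.2 else 0) (H ω, Y ω) := by
    ext ω
    simp [Set.indicator_apply]
  rw [h1, (hexp _).2]
  refine (Finset.sum_eq_zero fun h _ => ?_).symm
  by_cases ht : h ∈ t <;> simp [ht, hΦ]

/-! ### Path probabilities and the law of an episode -/

noncomputable section

namespace KieferWolfowitz

variable {S : Type*}

/-- The infinite path that follows `w` and then stays at its last state. -/
def extendPath {T : ℕ} (w : Fin (T + 1) → S) (t : ℕ) : S := w ⟨min t T, by omega⟩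

theorem extendPath_of_le {T : ℕ} (w : Fin (T + 1) → S) {t : ℕ} (ht : t ≤ T) :
    extendPath w t = w ⟨t, by omega⟩ := by
  simp [extendPath, ht]

theorem pathProb_congr [DecidableEq S] (P : Matrix S S ℝ) (x : S) {T : ℕ} {w w' : ℕ → S}
    (h : ∀ t ≤ T, w t = w' t) : pathProb P x T w = pathProb P x T w' := by
  unfold pathProb
  rw [h 0 (Nat.zero_le _)]
  congr 1
  refine Finset.prod_congr rfl fun t ht => ?_
  have := Finset.mem_range.1 ht
  rw [h t (by omega), h (t + 1) (by omega)]

theorem pathProb_succ [DecidableEq S] (P : Matrix S S ℝ) (x : S) (T : ℕ) (w : ℕ → S) :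
    pathProb P x (T + 1) w = pathProb P x T w * P (w T) (w (T + 1)) := by
  simp [pathProb, Finset.prod_range_succ]

/-- The final state of a Markov chain run for `T` steps from `x` has law `(P ^ T) x`. -/
theorem sum_pathProb_mul [Fintype S] [DecidableEq S] (P : Matrix S S ℝ) (x : S) (T : ℕ)
    (φ : S → ℝ) :
    ∑ w : Fin (T + 1) → S, pathProb P x T (extendPath w) * φ (extendPath w T)
      = ∑ y, (P ^ T) x y * φ y := by
  induction T generalizing φ with
  | zero =>
    rw [← (Equiv.funUnique (Fin 1) S).symm.sum_comp]
    refine Finset.sum_congr rfl fun y _ => ?_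
    simp [pathProb, extendPath, Matrix.one_apply, eq_comm]
  | succ T ih =>
    rw [← (Fin.snocEquiv fun _ => S).sum_comp, Fintype.sum_prod_type_right]
    have hinit : ∀ (w : Fin (T + 1) → S) (s : S), ∀ t ≤ T,
        extendPath (Fin.snocEquiv (fun _ => S) (s, w)) t = extendPath w t := by
      intro w s t ht
      rw [extendPath_of_le _ ht, extendPath_of_le _ (by omega)]
      exact Fin.snoc_castSucc (α := fun _ => S) s w ⟨t, by omega⟩
    have hlast : ∀ (w : Fin (T + 1) → S) (s : S),
        extendPath (Fin.snocEquiv (fun _ => S) (s, w)) (T + 1) = s := by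
      intro w s
      rw [extendPath_of_le _ le_rfl]
      exact Fin.snoc_last (α := fun _ => S) s w
    calc _ = ∑ w : Fin (T + 1) → S, pathProb P x T (extendPath w)
            * ∑ s, P (extendPath w T) s * φ s := by
          refine Finset.sum_congr rfl fun w _ => ?_
          rw [Finset.mul_sum]
          refine Finset.sum_congr rfl fun s _ => ?_
          rw [pathProb_succ, pathProb_congr P x (hinit w s), hinit w s T le_rfl, hlast]
          ring
      _ = _ := by
          rw [ih fun y => ∑ s, P y s * φ s]
          simp only [pow_succ, Matrix.mul_apply, Finset.mul_sum, Finset.sum_mul]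
          rw [Finset.sum_comm]
          refine Finset.sum_congr rfl fun s _ => Finset.sum_congr rfl fun y _ => ?_
          ring

/-- A sum of centred functions of the independent components has mean zero. -/
theorem sum_prod_mul_sum_eq_zero {ι A : Type*} [Fintype ι] [DecidableEq ι] [Fintype A]
    {α φ : A → ℝ} (h : ∑ x, α x * φ x = 0) :
    ∑ e : ι → A, (∏ i, α (e i)) * ∑ i, φ (e i) = 0 := by
  simp only [Finset.mul_sum]
  rw [Finset.sum_comm]
  refine Finset.sum_eq_zero fun j _ => ?_
  have h1 : ∀ e : ι → A, (∏ i, α (e i)) * φ (e j)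
      = ∏ i, α (e i) * (if i = j then φ (e i) else 1) := fun e => by
    rw [Finset.prod_mul_distrib]
    simp
  simp only [h1]
  have h2 := (Finset.prod_univ_sum (fun _ : ι => (Finset.univ : Finset A))
    (fun i x => α x * (if i = j then φ x else 1)))
  rw [Fintype.piFinset_univ] at h2
  rw [← h2]
  exact Finset.prod_eq_zero (Finset.mem_univ j) (by simpa using h)

namespace Input

theorem iterate_congr (D : Input S) {yp ym yp' ym' : ℕ → Fin D.K → ℕ → S} {n : ℕ}
    (hp : ∀ k < n, ∀ i, yp k i (D.τ k) = yp' k i (D.τ k))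
    (hm : ∀ k < n, ∀ i, ym k i (D.τ k) = ym' k i (D.τ k)) :
    D.iterate yp ym n = D.iterate yp' ym' n := by
  induction n with
  | zero => rfl
  | succ n ih =>
    simp only [iterate]
    rw [ih (fun k hk => hp k (by omega)) (fun k hk => hm k (by omega))]
    simp only [hp n (Nat.lt_succ_self n), hm n (Nat.lt_succ_self n)]

/-- The trajectories simulated in episode `n`: for each index, the one with the increased and
the one with the decreased parameter. -/
abbrev Episode (D : Input S) (n : ℕ) : Type _ :=
  Fin D.K → (Fin (D.τ n + 1) → S) × (Fin (D.τ n + 1) → S)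

/-- The trajectories simulated before episode `n`. -/
abbrev History (D : Input S) (n : ℕ) : Type _ := (k : Fin n) → D.Episode k

variable {Ω : Type*}

/-- The trajectories of episode `n` as a random variable. -/
def episode (D : Input S) (Xp Xm : ℕ → Fin D.K → ℕ → Ω → S) (n : ℕ) (ω : Ω) : D.Episode n :=
  fun i => (fun t => Xp n i t ω, fun t => Xm n i t ω)

/-- The history before episode `n` as a random variable. -/
def history (D : Input S) (Xp Xm : ℕ → Fin D.K → ℕ → Ω → S) (n : ℕ) (ω : Ω) : D.History n :=
  fun k => D.episode Xp Xm k ω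

/-- The iterate `θ_n` as a function of the history; the trajectories of later episodes do not
enter, and are given the value `xstart`. -/
def iterateOf (D : Input S) {n : ℕ} (h : D.History n) : ℝ :=
  D.iterate (fun k i t => if hk : k < n then extendPath (h ⟨k, hk⟩ i).1 t else D.xstart)
    (fun k i t => if hk : k < n then extendPath (h ⟨k, hk⟩ i).2 t else D.xstart) n

theorem iterateOf_history (D : Input S) (Xp Xm : ℕ → Fin D.K → ℕ → Ω → S) (n : ℕ) (ω : Ω) :
    D.iterateOf (D.history Xp Xm n ω)
      = D.iterate (fun k i t => Xp k i t ω) (fun k i t => Xm k i t ω) n := by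
  refine D.iterate_congr ?_ ?_ <;> intro k hk i <;>
    simp [hk, history, episode, extendPath]

section Simulation

variable [MeasurableSpace S] [MeasurableSpace Ω] [DecidableEq S]
  {D : Input S} {μ : Measure Ω} {Xp Xm : ℕ → Fin D.K → ℕ → Ω → S}

theorem IsSimulation.measurable_episode (hX : D.IsSimulation μ Xp Xm) (n : ℕ) :
    Measurable (D.episode Xp Xm n) :=
  measurable_pi_lambda _ fun i => Measurable.prodMk
    (f := fun ω (t : Fin (D.τ n + 1)) => Xp n i t ω)
    (g := fun ω (t : Fin (D.τ n + 1)) => Xm n i t ω)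
    (measurable_pi_lambda _ fun t => hX.measurable_plus n i t)
    (measurable_pi_lambda _ fun t => hX.measurable_minus n i t)

theorem IsSimulation.measurable_history (hX : D.IsSimulation μ Xp Xm) (n : ℕ) :
    Measurable (D.history Xp Xm n) :=
  measurable_pi_lambda _ fun k => hX.measurable_episode k

/-- The filtration generated by the past episodes. -/
def IsSimulation.filtration (hX : D.IsSimulation μ Xp Xm) :
    Filtration ℕ (inferInstance : MeasurableSpace Ω) where
  seq n := MeasurableSpace.comap (D.history Xp Xm n) inferInstance
  mono' := by
    intro n k hnk
    have : D.history Xp Xm n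
        = (fun (h : D.History k) (j : Fin n) => h (j.castLE hnk)) ∘ D.history Xp Xm k := rfl
    dsimp only
    rw [this, ← MeasurableSpace.comap_comp]
    refine MeasurableSpace.comap_mono ?_
    exact (measurable_pi_lambda _ fun j => measurable_pi_apply (j.castLE hnk)).comap_le
  le' n := (hX.measurable_history n).comap_le

/-- The probability of the two trajectories `w` when the current iterate is `θ`. -/
def pairProb (D : Input S) (n : ℕ) (θ : ℝ)
    (w : (Fin (D.τ n + 1) → S) × (Fin (D.τ n + 1) → S)) : ℝ :=
  pathProb (D.P (θ + D.δ n)) D.xstart (D.τ n) (extendPath w.1)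
    * pathProb (D.P (θ - D.δ n)) D.xstart (D.τ n) (extendPath w.2)

/-- Given the history `h`, the trajectories of episode `n` are independent with law `pairProb`. -/
theorem IsSimulation.measureReal_history_episode (hX : D.IsSimulation μ Xp Xm) (n : ℕ) :
    ∃ p : D.History n → ℝ, ∀ (h : D.History n) (e : D.Episode n),
      μ.real {ω | D.history Xp Xm n ω = h ∧ D.episode Xp Xm n ω = e}
        = p h * ∏ i, D.pairProb n (D.iterateOf h) (e i) := by
  set yp : D.History n → D.Episode n → ℕ → Fin D.K → ℕ → S := fun h e k i t =>
    if hk : k < n then extendPath (h ⟨k, hk⟩ i).1 t else extendPath (e i).1 t with hyp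
  set ym : D.History n → D.Episode n → ℕ → Fin D.K → ℕ → S := fun h e k i t =>
    if hk : k < n then extendPath (h ⟨k, hk⟩ i).2 t else extendPath (e i).2 t with hym
  have hit : ∀ h e, ∀ k ≤ n, D.iterate (yp h e) (ym h e) k
      = D.iterate (fun k i t => if hk : k < n then extendPath (h ⟨k, hk⟩ i).1 t else D.xstart)
        (fun k i t => if hk : k < n then extendPath (h ⟨k, hk⟩ i).2 t else D.xstart) k := by
    intro h e k hk
    refine D.iterate_congr ?_ ?_ <;> intro j hj i <;> have hjn : j < n := by omega
    all_goals simp [hyp, hym, hjn]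
  refine ⟨fun h => ∏ k : Fin n, ∏ i, D.pairProb k (D.iterate
    (fun k i t => if hk : k < n then extendPath (h ⟨k, hk⟩ i).1 t else D.xstart)
    (fun k i t => if hk : k < n then extendPath (h ⟨k, hk⟩ i).2 t else D.xstart) k) (h k i),
    fun h e => ?_⟩
  have hset : {ω | D.history Xp Xm n ω = h ∧ D.episode Xp Xm n ω = e}
      = {ω | ∀ k < n + 1, ∀ i, ∀ t ≤ D.τ k,
          Xp k i t ω = yp h e k i t ∧ Xm k i t ω = ym h e k i t} := by
    ext ω
    simp only [Set.mem_ofPred_eq]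
    constructor
    · rintro ⟨rfl, rfl⟩ k hk i t ht
      by_cases hkn : k < n
      · simp [hyp, hym, hkn, history, episode, extendPath, ht]
      · obtain rfl : k = n := by omega
        simp [hyp, hym, episode, extendPath, ht]
    · intro H
      constructor
      · funext k i
        refine Prod.ext (funext fun t => ?_) (funext fun t => ?_)
        · have := (H k (by omega) i t (by omega)).1
          simpa [hyp, history, episode, extendPath_of_le _ (Nat.lt_succ_iff.1 t.2)] using this
        · have := (H k (by omega) i t (by omega)).2
          simpa [hym, history, episode, extendPath_of_le _ (Nat.lt_succ_iff.1 t.2)] using this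
      · funext i
        refine Prod.ext (funext fun t => ?_) (funext fun t => ?_)
        · have := (H n (by omega) i t (by omega)).1
          simpa [hyp, episode, extendPath_of_le _ (Nat.lt_succ_iff.1 t.2)] using this
        · have := (H n (by omega) i t (by omega)).2
          simpa [hym, episode, extendPath_of_le _ (Nat.lt_succ_iff.1 t.2)] using this
  rw [hset, hX.law, Finset.prod_range_succ, Finset.prod_range, hit h e n le_rfl]
  congr 1
  · refine Finset.prod_congr rfl fun k _ => Finset.prod_congr rfl fun i _ => ?_
    rw [hit h e k k.2.le]
    simp [pairProb, hyp, hym]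
  · refine Finset.prod_congr rfl fun i _ => ?_
    simp [pairProb, hyp, hym, iterateOf]

end Simulation

/-! ### The gradient estimate: noise and bias -/

/-- The mean of the cost `F θ` at the end of a simulation of length `τ n` with parameter `θ`. -/
def simCost [Fintype S] [DecidableEq S] (D : Input S) (n : ℕ) (θ : ℝ) : ℝ :=
  ∑ y, (D.P θ ^ D.τ n) D.xstart y * D.F θ y

/-- The error of the gradient estimate of episode `n` with respect to its conditional mean, when
the current iterate is `θ` and the simulated trajectories are `e`. -/
def noise [Fintype S] [DecidableEq S] (D : Input S) (n : ℕ) (θ : ℝ) (e : D.Episode n) : ℝ :=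
  (D.fHat (θ + D.δ n) (fun i => extendPath (e i).1 (D.τ n))
    - D.fHat (θ - D.δ n) (fun i => extendPath (e i).2 (D.τ n))
    - (D.simCost n (θ + D.δ n) - D.simCost n (θ - D.δ n))) / (2 * D.δ n)

theorem sum_pow_row [Fintype S] [DecidableEq S] {D : Input S}
    (hP : ∀ θ, D.P θ ∈ Matrix.rowStochastic ℝ S) (θ : ℝ) (t : ℕ) (x : S) :
    ∑ y, (D.P θ ^ t) x y = 1 :=
  Matrix.sum_row_of_mem_rowStochastic (pow_mem (hP θ) t) x

theorem sum_pairProb_mul_noise [Fintype S] [DecidableEq S] {D : Input S} (hK : 0 < D.K)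
    (hP : ∀ θ, D.P θ ∈ Matrix.rowStochastic ℝ S) (n : ℕ) (θ : ℝ) :
    ∑ e : D.Episode n, (∏ i, D.pairProb n θ (e i)) * D.noise n θ e = 0 := by
  set φ : (Fin (D.τ n + 1) → S) × (Fin (D.τ n + 1) → S) → ℝ := fun w =>
    D.F (θ + D.δ n) (extendPath w.1 (D.τ n)) - D.F (θ - D.δ n) (extendPath w.2 (D.τ n))
      - (D.simCost n (θ + D.δ n) - D.simCost n (θ - D.δ n)) with hφ
  have hK' : (D.K : ℝ) ≠ 0 := by positivity
  have hnoise : ∀ e, D.noise n θ e = (∑ i, φ (e i)) * (1 / D.K / (2 * D.δ n)) := by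
    intro e
    simp only [noise, fHat, hφ, Finset.sum_sub_distrib, Finset.sum_const, Finset.card_univ,
      Fintype.card_fin, nsmul_eq_mul]
    field_simp
  simp only [hnoise, ← mul_assoc, ← Finset.sum_mul]
  rw [sum_prod_mul_sum_eq_zero, zero_mul]
  have hsum : ∀ θ' : ℝ, ∑ w : Fin (D.τ n + 1) → S,
      pathProb (D.P θ') D.xstart (D.τ n) (extendPath w) = 1 := by
    intro θ'
    simpa [sum_pow_row hP] using sum_pathProb_mul (D.P θ') D.xstart (D.τ n) fun _ => 1
  have hmean : ∀ θ' : ℝ, ∑ w : Fin (D.τ n + 1) → S,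
      pathProb (D.P θ') D.xstart (D.τ n) (extendPath w) * D.F θ' (extendPath w (D.τ n))
        = D.simCost n θ' := fun θ' => sum_pathProb_mul _ _ _ _
  have hsplit : ∀ u v : Fin (D.τ n + 1) → S, D.pairProb n θ (u, v) * φ (u, v)
      = (pathProb (D.P (θ + D.δ n)) D.xstart (D.τ n) (extendPath u)
          * D.F (θ + D.δ n) (extendPath u (D.τ n)))
          * pathProb (D.P (θ - D.δ n)) D.xstart (D.τ n) (extendPath v)
        - pathProb (D.P (θ + D.δ n)) D.xstart (D.τ n) (extendPath u)
          * (pathProb (D.P (θ - D.δ n)) D.xstart (D.τ n) (extendPath v)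
            * D.F (θ - D.δ n) (extendPath v (D.τ n)))
        - pathProb (D.P (θ + D.δ n)) D.xstart (D.τ n) (extendPath u)
          * (pathProb (D.P (θ - D.δ n)) D.xstart (D.τ n) (extendPath v)
            * (D.simCost n (θ + D.δ n) - D.simCost n (θ - D.δ n))) := by
    intro u v
    simp only [pairProb, hφ]
    ring
  rw [Fintype.sum_prod_type]
  simp only [hsplit, Finset.sum_sub_distrib, ← Finset.mul_sum, ← Finset.sum_mul, hsum, hmean]
  ring

/-- The noise is bounded by `gmax / δ n`: the unbounded part `b θ` of the cost does not depend on
the state, and drops out. -/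
theorem abs_noise_le [Fintype S] [DecidableEq S] {D : Input S} (hK : 0 < D.K)
    (hP : ∀ θ, D.P θ ∈ Matrix.rowStochastic ℝ S) {g : ℝ → S → ℝ} {b : ℝ → ℝ} {gmax : ℝ}
    (hF : ∀ θ x, D.F θ x = g θ x + b θ) (hg : ∀ θ x, 0 ≤ g θ x ∧ g θ x ≤ gmax) {n : ℕ}
    (hδ : 0 < D.δ n) (θ : ℝ) (e : D.Episode n) : |D.noise n θ e| ≤ gmax / D.δ n := by
  have hK' : (0 : ℝ) < D.K := by positivity
  have hhat : ∀ θ' (x : Fin D.K → S), b θ' ≤ D.fHat θ' x ∧ D.fHat θ' x ≤ gmax + b θ' := by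
    intro θ' x
    have h0 : D.fHat θ' x = 1 / D.K * ∑ i, g θ' (x i) + b θ' := by
      simp only [fHat, hF, Finset.sum_add_distrib, Finset.sum_const, Finset.card_univ,
        Fintype.card_fin, nsmul_eq_mul]
      field_simp
    have h1 : 0 ≤ ∑ i, g θ' (x i) := Finset.sum_nonneg fun i _ => (hg _ _).1
    have h2 : ∑ i, g θ' (x i) ≤ D.K * gmax := by
      simpa using Finset.sum_le_sum fun (i : Fin D.K) (_ : i ∈ Finset.univ) => (hg θ' (x i)).2
    have h3 : 1 / (D.K : ℝ) * ∑ i, g θ' (x i) ≤ gmax := by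
      rw [one_div, inv_mul_le_iff₀ hK']; exact h2
    have h4 : 0 ≤ 1 / (D.K : ℝ) * ∑ i, g θ' (x i) := by positivity
    constructor <;> linarith
  have hsim : ∀ θ', b θ' ≤ D.simCost n θ' ∧ D.simCost n θ' ≤ gmax + b θ' := by
    intro θ'
    have hnn : ∀ y, 0 ≤ (D.P θ' ^ D.τ n) D.xstart y := fun y =>
      Matrix.nonneg_of_mem_rowStochastic (pow_mem (hP θ') _)
    have h0 : ∀ c : ℝ, ∑ y, (D.P θ' ^ D.τ n) D.xstart y * c = c := fun c => by
      rw [← Finset.sum_mul, sum_pow_row hP, one_mul]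
    constructor
    · rw [← h0 (b θ')]
      refine Finset.sum_le_sum fun y _ => mul_le_mul_of_nonneg_left ?_ (hnn y)
      rw [hF]; linarith [(hg θ' y).1]
    · rw [← h0 (gmax + b θ')]
      refine Finset.sum_le_sum fun y _ => mul_le_mul_of_nonneg_left ?_ (hnn y)
      rw [hF]; linarith [(hg θ' y).2]
  have h1 := hhat (θ + D.δ n) fun i => extendPath (e i).1 (D.τ n)
  have h2 := hhat (θ - D.δ n) fun i => extendPath (e i).2 (D.τ n)
  have h3 := hsim (θ + D.δ n)
  have h4 := hsim (θ - D.δ n)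
  rw [noise, abs_div, abs_of_pos (show 0 < 2 * D.δ n by positivity), div_le_div_iff₀
    (by positivity) hδ]
  have h5 : |D.fHat (θ + D.δ n) (fun i => extendPath (e i).1 (D.τ n))
    - D.fHat (θ - D.δ n) (fun i => extendPath (e i).2 (D.τ n))
    - (D.simCost n (θ + D.δ n) - D.simCost n (θ - D.δ n))| ≤ 2 * gmax := by
    rw [abs_le]; constructor <;> linarith
  nlinarith

/-- Stopping the simulations after `τ n` steps biases the mean cost by `O(ρ ^ τ n)`, uniformly in
the parameter; again `b θ` drops out. -/
theorem abs_simCost_sub_statCost_le [Fintype S] [DecidableEq S] {D : Input S}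
    (hP : ∀ θ, D.P θ ∈ Matrix.rowStochastic ℝ S) {m : ℝ → S → ℝ}
    (hm : ∀ θ, IsStationary (D.P θ) (m θ)) {C₁ ρ : ℝ}
    (hmix : UniformMixing D.P m D.xstart C₁ ρ) {g : ℝ → S → ℝ} {b : ℝ → ℝ} {gmax : ℝ}
    (hF : ∀ θ x, D.F θ x = g θ x + b θ) (hg : ∀ θ x, 0 ≤ g θ x ∧ g θ x ≤ gmax) (n : ℕ) (θ : ℝ) :
    |D.simCost n θ - D.statCost m θ| ≤ gmax * C₁ * ρ ^ D.τ n := by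
  have h0 : D.simCost n θ - D.statCost m θ
      = ∑ y, ((D.P θ ^ D.τ n) D.xstart y - m θ y) * g θ y := by
    have h1 : ∑ y, ((D.P θ ^ D.τ n) D.xstart y - m θ y) * b θ = 0 := by
      rw [← Finset.sum_mul, Finset.sum_sub_distrib, sum_pow_row hP, (hm θ).1.2]; simp
    rw [← add_zero (∑ y, _ * g θ y), ← h1, simCost, statCost, ← Finset.sum_sub_distrib,
      ← Finset.sum_add_distrib]
    refine Finset.sum_congr rfl fun y _ => ?_
    rw [hF]; ring
  have hgmax : 0 ≤ gmax := (hg 0 D.xstart).1.trans (hg 0 D.xstart).2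
  calc |D.simCost n θ - D.statCost m θ|
      ≤ ∑ y, |((D.P θ ^ D.τ n) D.xstart y - m θ y) * g θ y| := by
        rw [h0]; exact Finset.abs_sum_le_sum_abs _ _
    _ ≤ ∑ y, |(D.P θ ^ D.τ n) D.xstart y - m θ y| * gmax := by
        refine Finset.sum_le_sum fun y _ => ?_
        rw [abs_mul, abs_of_nonneg (hg θ y).1]
        exact mul_le_mul_of_nonneg_left (hg θ y).2 (abs_nonneg _)
    _ ≤ (C₁ * ρ ^ D.τ n) * gmax := by
        rw [← Finset.sum_mul]
        exact mul_le_mul_of_nonneg_right (hmix.2.2 θ _) hgmax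
    _ = _ := by ring

/-- The series of the noise terms, weighted by the step sizes, converges almost surely. -/
theorem IsSimulation.ae_exists_tendsto_sum_noise [Fintype S] [DecidableEq S] [MeasurableSpace S]
    [MeasurableSingletonClass S] {Ω : Type*} [MeasurableSpace Ω] {μ : Measure Ω}
    [IsProbabilityMeasure μ] {D : Input S} {Xp Xm : ℕ → Fin D.K → ℕ → Ω → S}
    (hX : D.IsSimulation μ Xp Xm) (hK : 0 < D.K) (hP : ∀ θ, D.P θ ∈ Matrix.rowStochastic ℝ S)
    (hD : D.Parametrization) {g : ℝ → S → ℝ} {b : ℝ → ℝ} {gmax : ℝ}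
    (hF : ∀ θ x, D.F θ x = g θ x + b θ) (hg : ∀ θ x, 0 ≤ g θ x ∧ g θ x ≤ gmax) :
    ∀ᵐ ω ∂μ, ∃ l, Tendsto (fun N => ∑ n ∈ Finset.range N,
      D.a n * D.noise n (D.iterateOf (D.history Xp Xm n ω)) (D.episode Xp Xm n ω))
      atTop (𝓝 l) := by
  refine ae_exists_tendsto_sum_of_condExp_eq_zero (ℱ := hX.filtration)
    (c := fun n => D.a n * (gmax / D.δ n)) ?_ ?_ ?_ ?_
  · refine (hD.a_sq_sum.mul_left (gmax ^ 2)).congr fun n => ?_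
    have := (hD.δ_pos n).ne'
    field_simp
  · intro n
    -- Both arguments are functions of the history before episode `n + 1`.
    set u : D.History (n + 1) → ℝ := fun h =>
      D.a n * D.noise n (D.iterateOf fun k : Fin n => h k.castSucc) (h (Fin.last n))
    have hu : Measurable u := measurable_of_finite u
    exact (hu.comp (comap_measurable (D.history Xp Xm (n + 1)))).stronglyMeasurable
  · intro n ω
    rw [abs_mul, abs_of_pos (hD.a_pos n)]
    exact mul_le_mul_of_nonneg_left (abs_noise_le hK hP hF hg (hD.δ_pos n) _ _) (hD.a_pos n).le
  · intro n
    obtain ⟨p, hp⟩ := hX.measureReal_history_episode n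
    refine condExp_comap_eq_zero (Φ := fun h e => D.a n * D.noise n (D.iterateOf h) e)
      (hX.measurable_history n) (hX.measurable_episode n) hp fun h => ?_
    have := sum_pairProb_mul_noise hK hP n (D.iterateOf h)
    simp only [mul_left_comm _ (D.a n), ← Finset.mul_sum, this, mul_zero]

end Input

end KieferWolfowitz

end

/-! ### Almost sure convergence of the iterates -/

theorem theorem1 {S : Type*} [Fintype S] [DecidableEq S] [MeasurableSpace S]
    [MeasurableSingletonClass S] {Ω : Type*} [MeasurableSpace Ω] (μ : Measure Ω)
    [IsProbabilityMeasure μ] (D : KieferWolfowitz.Input S) (hK : 0 < D.K)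
    (hP : ∀ θ, D.P θ ∈ Matrix.rowStochastic ℝ S)
    (hD : D.Parametrization)
    (m : ℝ → S → ℝ) (hm : ∀ θ, KieferWolfowitz.IsStationary (D.P θ) (m θ))
    (θstar : ℝ) (hreg : KieferWolfowitz.RegularCost D.F (D.statCost m) θstar)
    (C₁ ρ : ℝ) (hmix : KieferWolfowitz.UniformMixing D.P m D.xstart C₁ ρ)
    (hτ : Summable (fun n => ρ ^ D.τ n))
    (hmin : ∀ θ, D.statCost m θstar ≤ D.statCost m θ)
    (hunique : ∀ θ, deriv (D.statCost m) θ = 0 → θ = θstar)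
    (Xp Xm : ℕ → Fin D.K → ℕ → Ω → S) (hX : D.IsSimulation μ Xp Xm) :
    ∀ᵐ ω ∂μ, Tendsto
      (fun n => D.iterate (fun k i t => Xp k i t ω) (fun k i t => Xm k i t ω) n)
      atTop (𝓝 θstar) := by
  obtain ⟨hC3, ⟨Λ, hΛ⟩, ⟨g, b, gmax, C₂, ε₀, -, -, hF, hg, -⟩, L, r, -, hr, hLp, hLm⟩ := hreg
  set f := D.statCost m with hf
  have hdiff : Differentiable ℝ f := hC3.differentiable (by norm_num)
  have hzero : deriv f θstar = 0 :=
    IsLocalMin.deriv_eq_zero (Eventually.of_forall fun θ => hmin θ)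
  -- The drift condition for `-f'` at `-x` gives the bound to the left of `θstar`.
  have hsep : ∀ ε > 0, ∃ c > 0, ∀ x, (θstar + ε ≤ x → c ≤ deriv f x) ∧
      (x ≤ θstar - ε → deriv f x ≤ -c) := by
    intro ε hε
    obtain ⟨c, hc, hcs⟩ := exists_pos_le_of_forall_ne_zero hΛ.continuous hr
      (fun x hx h0 => hx.ne' (hunique x h0)) hLp hε
    obtain ⟨c', hc', hcs'⟩ := exists_pos_le_of_forall_ne_zero (h := fun x => -deriv f (-x))
      (s := -θstar) (L := L) (hΛ.continuous.comp continuous_neg).neg hr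
      (fun x hx h0 => by linarith [hunique (-x) (neg_eq_zero.1 h0)])
      (fun x hx => by linarith [hLm (-x) (by linarith)]) hε
    refine ⟨min c c', lt_min hc hc', fun x => ⟨fun hx => (min_le_left _ _).trans (hcs x hx),
      fun hx => ?_⟩⟩
    have := hcs' (-x) (by linarith)
    rw [neg_neg] at this
    linarith [min_le_right c c']
  have ha0 : Tendsto D.a atTop (𝓝 0) := by
    have h1 : Tendsto (fun n => D.a n / D.δ n) atTop (𝓝 0) := by
      have h2 : Tendsto (fun n => (D.a n / D.δ n) ^ 2) atTop (𝓝 0) := by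
        simpa [div_pow] using hD.a_sq_sum.tendsto_atTop_zero
      simpa [Real.sqrt_sq, (div_pos (hD.a_pos _) (hD.δ_pos _)).le] using h2.sqrt
    have h2 := h1.mul hD.δ_tendsto
    rw [zero_mul] at h2
    exact h2.congr fun n => div_mul_cancel₀ _ (hD.δ_pos n).ne'
  have hgmax : 0 ≤ gmax := (hg 0 D.xstart).1.trans (hg 0 D.xstart).2
  have hρ : ∀ n, 0 ≤ ρ ^ D.τ n := fun n =>
    nonneg_of_mul_nonneg_right
      ((Finset.sum_nonneg fun y _ => abs_nonneg _).trans (hmix.2.2 0 (D.τ n))) hmix.1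
  filter_upwards [hX.ae_exists_tendsto_sum_noise hK hP hD hF hg] with ω ⟨l, hl⟩
  set θ : ℕ → ℝ := D.iterate (fun k i t => Xp k i t ω) (fun k i t => Xm k i t ω) with hθ
  set bias : ℕ → ℝ := fun n =>
    D.a n * (((D.simCost n (θ n + D.δ n) - f (θ n + D.δ n))
      - (D.simCost n (θ n - D.δ n) - f (θ n - D.δ n))) / (2 * D.δ n)) with hbias
  have hbias_sum : Summable bias := by
    refine Summable.of_norm_bounded
      (g := fun n => D.a 0 / D.δ 0 * (gmax * C₁) * ρ ^ D.τ n) (hτ.mul_left _) fun n => ?_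
    have hδ := hD.δ_pos n
    have h1 := abs_le.1
      (KieferWolfowitz.Input.abs_simCost_sub_statCost_le hP hm hmix hF hg n (θ n + D.δ n))
    have h2 := abs_le.1
      (KieferWolfowitz.Input.abs_simCost_sub_statCost_le hP hm hmix hF hg n (θ n - D.δ n))
    have h3 : |(D.simCost n (θ n + D.δ n) - f (θ n + D.δ n))
        - (D.simCost n (θ n - D.δ n) - f (θ n - D.δ n))| ≤ 2 * (gmax * C₁ * ρ ^ D.τ n) :=
      abs_le.2 ⟨by linarith [h1.1, h2.2], by linarith [h1.2, h2.1]⟩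
    have h4 : 0 ≤ gmax * C₁ * ρ ^ D.τ n := mul_nonneg (mul_nonneg hgmax hmix.1.le) (hρ n)
    calc ‖bias n‖ = D.a n * (|(D.simCost n (θ n + D.δ n) - f (θ n + D.δ n))
          - (D.simCost n (θ n - D.δ n) - f (θ n - D.δ n))| / (2 * D.δ n)) := by
          rw [hbias, Real.norm_eq_abs, abs_mul, abs_div, abs_of_pos (hD.a_pos n),
            abs_of_pos (show 0 < 2 * D.δ n by positivity)]
      _ ≤ D.a n * (2 * (gmax * C₁ * ρ ^ D.τ n) / (2 * D.δ n)) := by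
          have := (hD.a_pos n).le
          gcongr
      _ = D.a n / D.δ n * (gmax * C₁ * ρ ^ D.τ n) := by field_simp
      _ ≤ D.a 0 / D.δ 0 * (gmax * C₁ * ρ ^ D.τ n) :=
          mul_le_mul_of_nonneg_right (hD.ratio_antitone (Nat.zero_le n)) h4
      _ = _ := by ring
  have hw := hl.add hbias_sum.hasSum.tendsto_sum_nat
  simp only [← Finset.sum_add_distrib] at hw
  refine tendsto_of_recursion hΛ hzero hsep hD.a_pos ha0 hD.a_sum
    (e := fun n => (f (θ n + D.δ n) - f (θ n - D.δ n)) / (2 * D.δ n) - deriv f (θ n)) ?_ hw ?_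
  · refine squeeze_zero_norm (a := fun n => Λ * D.δ n)
      (fun n => abs_centralDiff_sub_deriv_le hdiff hΛ (θ n) (hD.δ_pos n)) ?_
    simpa using hD.δ_tendsto.const_mul (Λ : ℝ)
  · intro n
    have hstep : θ (n + 1) = θ n - D.a n *
        ((D.fHat (θ n + D.δ n) (fun i => Xp n i (D.τ n) ω)
          - D.fHat (θ n - D.δ n) (fun i => Xm n i (D.τ n) ω)) / (2 * D.δ n)) := rfl
    have hit : D.iterateOf (D.history Xp Xm n ω) = θ n := D.iterateOf_history Xp Xm n ω
    have hn : D.noise n (θ n) (D.episode Xp Xm n ω)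
        = (D.fHat (θ n + D.δ n) (fun i => Xp n i (D.τ n) ω)
          - D.fHat (θ n - D.δ n) (fun i => Xm n i (D.τ n) ω)
          - (D.simCost n (θ n + D.δ n) - D.simCost n (θ n - D.δ n))) / (2 * D.δ n) := by
      simp [KieferWolfowitz.Input.noise, KieferWolfowitz.Input.episode,
        KieferWolfowitz.extendPath]
    rw [hstep, hit, hn]
    simp only [hbias]
    ring
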